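/- Conventions. All lattices have a bottom element $0$ and a top element $1$ (possibly $0=1$), sublattices contain $0$ and $1$, and lattice homomorphisms preserve $0$ and $1$. For a family $S$ of subsets of a set $X$, let $\mathcal T^+$ (resp. $\mathcal T^-$) be the topology on $S$ with subbase $\{\{p\in S: x\notin p\}: x\in X\}$ (resp. $\{\{p\in S: x\in p\}: x\in X\}$). For a bitopological space $(S,\mathcal T^+,\mathcal T^-)$ put $\mathcal L^+=\{U\in\mathcal T^+: S\setminus U\in\mathcal T^-\}$ and $\mathcal L^-=\{U\in\mathcal T^-: S\setminus U\in\mathcal T^+\}$. A non-empty bitopological space is an *abstract spectrum* if $\mathcal L^+$ is a base of $\mathcal T^+$ and $\mathcal L^-$ is a base of $\mathcal T^-$; every $\mathcal T^+$-closed set is $\mathcal T^-$-compact and every $\mathcal T^-$-closed set is $\mathcal T^+$-compact (compactness does not include the Hausdorff property); and at least one of $\mathcal T^+$, $\mathcal T^-$ is $T_0$. An *$\mathbf S$-morphism* is a map that is continuous both for the topologies $\mathcal T^+$ and for the topologies $\mathcal T^-$; an *$\mathbf S$-isomorphism* is an $\mathbf S$-morphism with a two-sided inverse that is an $\mathbf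 S$-morphism. For a distributive lattice $L$, $\operatorname{spec}(L)$ is the set of proper prime ideals of $L$ with the topologies $\mathcal T^\pm$ above (as a family of subsets of $L$). Theorem 2.4.1. Let $X$ be a set and $S$ a family of subsets of $X$ such that $(S,\mathcal T^+,\mathcal T^-)$ is an abstract spectrum. Then there exist a distributive lattice $L$ with $0$ and $1$ and a function $\varphi:X\to L$ such that: (i) $\varphi(X)$ generates $L$ (as a lattice with $0$ and $1$); (ii) $\varphi^{-1}(q)\in S$ for every $q\in\operatorname{spec}(L)$; (iii) $\operatorname{spec}(L)$ is an abstract spectrum and $\Phi:\operatorname{spec}(L)\to S$, $q\mapsto\varphi^{-1}(q)$, is an $\mathbf S$-isomorphism; (iv) if $L'$ is a distributive lattice with $0$ and $1$ and $\theta:X\to L'$ is a function such that $\theta^{-1}(q)\in S$ for every $q\in\operatorname{spec}(L')$ and $\Theta:\operatorname{spec}(L')\to S$, $q\mapsto\theta^{-1}(q)$, is an $\mathbf S$-morphism, then there exists a unique lattice homomorphism $l:L\to L'$ with $l\circ\varphi=\theta$; (v) if $L_1$ is a distributive lattice with $0$ and $1$ and $\varphi_1:X\to L_1$ is a function such that $\varphi_1^{-1}(q)\in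 S$ for every $q\in\operatorname{spec}(L_1)$ and $\Phi_1:\operatorname{spec}(L_1)\to S$, $q\mapsto\varphi_1^{-1}(q)$, is an $\mathbf S$-isomorphism, then there exists a unique lattice isomorphism $l:L\to L_1$ with $l\circ\varphi=\varphi_1$; (vi) $\varphi$ is injective if and only if for any two different points $x,y\in X$ there exists a $p\in S$ containing exactly one of them. -/

import Mathlib

open scoped Topology

universe u v

namespace Spectra

/-- A bitopology `(𝒯⁺, 𝒯⁻)` on a type. -/
structure Bitopology (A : Type u) where
  pos : TopologicalSpace A
  neg : TopologicalSpace A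

namespace Bitopology

variable {A : Type u} {B : Type v}

/-- `ℒ⁺`: the `𝒯⁺`-open sets whose complement is `𝒯⁻`-open. -/
def posClopen (T : Bitopology A) : Set (Set A) :=
  {U | IsOpen[T.pos] U ∧ IsOpen[T.neg] Uᶜ}

/-- `ℒ⁻`: the `𝒯⁻`-open sets whose complement is `𝒯⁺`-open. -/
def negClopen (T : Bitopology A) : Set (Set A) :=
  {U | IsOpen[T.neg] U ∧ IsOpen[T.pos] Uᶜ}

/-- Abstract spectra. -/
structure IsAbstractSpectrum (T : Bitopology A) : Prop where
  nonempty : Nonempty A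
  basis_pos : @TopologicalSpace.IsTopologicalBasis A T.pos T.posClopen
  basis_neg : @TopologicalSpace.IsTopologicalBasis A T.neg T.negClopen
  compact_neg : ∀ F : Set A, IsOpen[T.pos] Fᶜ → @IsCompact A T.neg F
  compact_pos : ∀ F : Set A, IsOpen[T.neg] Fᶜ → @IsCompact A T.pos F
  t0 : @T0Space A T.pos ∨ @T0Space A T.neg

/-- `f` is continuous for both topologies (an `𝐒`-morphism, for maps of abstract spectra). -/
def IsMorphism (T : Bitopology A) (T' : Bitopology B) (f : A → B) : Prop :=
  Continuous[T.pos, T'.pos] f ∧ Continuous[T.neg, T'.neg] f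

/-- `f` is a morphism with a two-sided inverse that is a morphism. -/
def IsIsomorphism (T : Bitopology A) (T' : Bitopology B) (f : A → B) : Prop :=
  T.IsMorphism T' f ∧
    ∃ g : B → A, T'.IsMorphism T g ∧ Function.LeftInverse g f ∧ Function.RightInverse g f

end Bitopology

/-- The bitopology on a family `S` of subsets of `X`: the sets `{p ∈ S : x ∉ p}` form a subbase of
`𝒯⁺` and the sets `{p ∈ S : x ∈ p}` form a subbase of `𝒯⁻`. -/
def familyBitopology {X : Type u} (S : Set (Set X)) : Bitopology S where
  pos := TopologicalSpace.generateFrom (Set.range fun x : X => {p : S | x ∉ (p : Set X)})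
  neg := TopologicalSpace.generateFrom (Set.range fun x : X => {p : S | x ∈ (p : Set X)})

/-- The set of all (proper) prime ideals of a lattice, as a family of subsets of it. As a
bitopological space it carries `familyBitopology (spec L)`, whose `𝒯⁺` is the Stone topology. -/
def spec (L : Type u) [Lattice L] : Set (Set L) :=
  {q | ∃ I : Order.Ideal L, I.IsPrime ∧ (I : Set L) = q}

/-- The map `spec L → S`, `q ↦ θ⁻¹(q)`. -/
def specMap {X : Type u} {L : Type v} [Lattice L] {S : Set (Set X)} (θ : X → L)
    (h : ∀ q ∈ spec L, θ ⁻¹' q ∈ S) : spec L → S :=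
  fun q => ⟨θ ⁻¹' q, h q q.2⟩

/-- `G` generates `L` as a lattice with `0` and `1`: the only sublattice of `L` that contains
`0`, `1` and `G` is `L` itself. -/
def Generates {L : Type u} [Lattice L] [BoundedOrder L] (G : Set L) : Prop :=
  ∀ M : Sublattice L, ⊥ ∈ M → ⊤ ∈ M → G ⊆ M → M = ⊤

end Spectra

/-!
The lattice `L` is `ℒ⁺` of the given spectrum `S`, and `φ x` is the subbasic set `{p ∈ S : x ∉ p}`.

Two dualities do the work. If `T` is an abstract spectrum, then every prime ideal `I` of `ℒ⁺(T)` is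
the ideal of sets avoiding some point: by compactness for both topologies, the intersection of the
sets outside `I` cannot be covered by the sets in `I`. If `L` is a distributive lattice, then
`a ↦ {q : a ∉ q}` is an isomorphism of `L` onto `ℒ⁺(spec L)`, by two applications of the prime ideal
theorem. Hence a morphism `Θ : spec L' → S` yields a homomorphism `ℒ⁺(S) → ℒ⁺(spec L') ≅ L'`. It is
unique because a compact open set lies in every sublattice that contains a subbase.
-/

namespace Spectra

section Topology

variable {A : Type u} {B : Type v}

theorem isTopologicalBasis_of_leftInverse [TopologicalSpace A] [TopologicalSpace B]
    {f : A → B} {g : B → A} (hg : Continuous g) (hgf : Function.LeftInverse g f)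
    {V : Set (Set A)} {W : Set (Set B)} (hW : TopologicalSpace.IsTopologicalBasis W)
    (hV : ∀ U ∈ V, IsOpen U) (hWV : ∀ U ∈ W, f ⁻¹' U ∈ V) :
    TopologicalSpace.IsTopologicalBasis V := by
  refine TopologicalSpace.isTopologicalBasis_of_isOpen_of_nhds hV fun a U ha hU => ?_
  have hfa : f a ∈ g ⁻¹' U := by rwa [Set.mem_preimage, hgf a]
  obtain ⟨w, hw, haw, hwU⟩ := hW.exists_subset_of_mem_open hfa (hU.preimage hg)
  exact ⟨f ⁻¹' w, hWV w hw, haw, fun b hb => hgf b ▸ hwU hb⟩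

theorem isCompact_of_isCompact_preimage [TopologicalSpace A] [TopologicalSpace B] {g : B → A}
    (hg : Continuous g) (hsurj : Function.Surjective g) {F : Set A} (hF : IsCompact (g ⁻¹' F)) :
    IsCompact F :=
  Set.image_preimage_eq F hsurj ▸ hF.image hg

theorem mem_of_isCompact_of_isOpen_of_supClosed [TopologicalSpace A] {b : Set (Set A)}
    (hb : TopologicalSpace.IsTopologicalBasis b) (hempty : ∅ ∈ b) (hsup : SupClosed b) {U : Set A}
    (hUc : IsCompact U) (hUo : IsOpen U) : U ∈ b := by
  obtain ⟨s, rfl⟩ := eq_sUnion_finset_of_isTopologicalBasis_of_isCompact_open b hb U hUc hUo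
  have hs : s.sup (fun V => (V : Set A)) ∈ b :=
    Finset.sup_induction hempty (fun _ hV _ hW => hsup hV hW) fun V _ => V.2
  simpa only [Set.sUnion_image, Finset.mem_coe, Finset.sup_set_eq_biUnion] using hs

end Topology

namespace Bitopology

variable {A : Type u} {B : Type v} {T : Bitopology A} {T' : Bitopology B}

theorem IsMorphism.preimage_mem_posClopen {f : A → B} (hf : T.IsMorphism T' f) {U : Set B}
    (hU : U ∈ T'.posClopen) : f ⁻¹' U ∈ T.posClopen :=
  ⟨continuous_def.1 hf.1 _ hU.1, continuous_def.1 hf.2 _ hU.2⟩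

theorem IsMorphism.preimage_mem_negClopen {f : A → B} (hf : T.IsMorphism T' f) {U : Set B}
    (hU : U ∈ T'.negClopen) : f ⁻¹' U ∈ T.negClopen :=
  ⟨continuous_def.1 hf.2 _ hU.1, continuous_def.1 hf.1 _ hU.2⟩

theorem IsAbstractSpectrum.of_isIsomorphism {f : A → B} (h : T'.IsAbstractSpectrum)
    (hf : T.IsIsomorphism T' f) : T.IsAbstractSpectrum := by
  obtain ⟨hf, g, hg, hgf, -⟩ := hf
  exact
    { nonempty := h.nonempty.map g
      basis_pos := @isTopologicalBasis_of_leftInverse A B T.pos T'.pos f g hg.1 hgf _ _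
        h.basis_pos (fun _ hU => hU.1) fun _ => hf.preimage_mem_posClopen
      basis_neg := @isTopologicalBasis_of_leftInverse A B T.neg T'.neg f g hg.2 hgf _ _
        h.basis_neg (fun _ hU => hU.1) fun _ => hf.preimage_mem_negClopen
      compact_neg := fun F hF => @isCompact_of_isCompact_preimage A B T.neg T'.neg g hg.2
        hgf.surjective F (h.compact_neg _ (continuous_def.1 hg.1 _ hF))
      compact_pos := fun F hF => @isCompact_of_isCompact_preimage A B T.pos T'.pos g hg.1
        hgf.surjective F (h.compact_pos _ (continuous_def.1 hg.2 _ hF))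
      t0 := h.t0.imp
        (@t0Space_of_injective_of_continuous A B T.pos T'.pos f hgf.injective hf.1)
        (@t0Space_of_injective_of_continuous A B T.neg T'.neg f hgf.injective hf.2) }

theorem empty_mem_posClopen (T : Bitopology A) : ∅ ∈ T.posClopen :=
  ⟨@isOpen_empty A T.pos, Set.compl_empty ▸ @isOpen_univ A T.neg⟩

theorem univ_mem_posClopen (T : Bitopology A) : Set.univ ∈ T.posClopen :=
  ⟨@isOpen_univ A T.pos, Set.compl_univ ▸ @isOpen_empty A T.neg⟩

theorem union_mem_posClopen {U V : Set A} (hU : U ∈ T.posClopen) (hV : V ∈ T.posClopen) :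
    U ∪ V ∈ T.posClopen :=
  ⟨@IsOpen.union A U V T.pos hU.1 hV.1,
    Set.compl_union U V ▸ @IsOpen.inter A T.neg _ _ hU.2 hV.2⟩

theorem inter_mem_posClopen {U V : Set A} (hU : U ∈ T.posClopen) (hV : V ∈ T.posClopen) :
    U ∩ V ∈ T.posClopen :=
  ⟨@IsOpen.inter A T.pos U V hU.1 hV.1,
    Set.compl_inter U V ▸ @IsOpen.union A _ _ T.neg hU.2 hV.2⟩

/-- The family `ℒ⁺` of a bitopological space as a lattice of sets, with union and intersection as
its operations. It is the lattice dual to the space. -/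
def posLattice (T : Bitopology A) : Sublattice (Set A) where
  carrier := T.posClopen
  supClosed' _ hU _ hV := union_mem_posClopen hU hV
  infClosed' _ hU _ hV := inter_mem_posClopen hU hV

instance (T : Bitopology A) : BoundedOrder T.posLattice :=
  Subtype.boundedOrder T.empty_mem_posClopen T.univ_mem_posClopen

/-- The lattice homomorphism `U ↦ f⁻¹(U)` dual to a morphism `f`; this is the action of the
contravariant functor `ℒ⁺` on morphisms. -/
def IsMorphism.comap {f : A → B} (hf : T.IsMorphism T' f) :
    BoundedLatticeHom T'.posLattice T.posLattice where
  toFun U := ⟨f ⁻¹' U, hf.preimage_mem_posClopen U.2⟩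
  map_sup' _ _ := rfl
  map_inf' _ _ := rfl
  map_top' := rfl
  map_bot' := rfl

theorem IsIsomorphism.comap_bijective {f : A → B} (hf : T.IsIsomorphism T' f) :
    Function.Bijective hf.1.comap := by
  obtain ⟨hf, g, hg, hgf, hfg⟩ := hf
  have hinv (U : Set A) : f ⁻¹' (g ⁻¹' U) = U := by
    rw [← Set.preimage_comp, hgf.comp_eq_id, Set.preimage_id]
  exact ⟨fun U V hUV => Subtype.ext (hfg.surjective.preimage_injective (Subtype.ext_iff.1 hUV)),
    fun U => ⟨hg.comap U, Subtype.ext (hinv U)⟩⟩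

/-- The ideal of the sets in `ℒ⁺` that do not contain a given point; the points of an abstract
spectrum are recovered from `ℒ⁺` as these ideals. -/
def pointIdeal (T : Bitopology A) (a : A) : Order.Ideal T.posLattice where
  carrier := {U | a ∉ (U : Set A)}
  lower' _ _ hVU hU hV := hU (hVU hV)
  nonempty' := ⟨⊥, Set.notMem_empty a⟩
  directed' U hU V hV := ⟨U ⊔ V, not_or.2 ⟨hU, hV⟩, le_sup_left (a := U), le_sup_right (b := V)⟩

theorem pointIdeal_isPrime (T : Bitopology A) (a : A) : (T.pointIdeal a).IsPrime := by
  have : (T.pointIdeal a).IsProper :=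
    Order.Ideal.isProper_of_notMem (p := ⊤) fun h => h (Set.mem_univ a)
  exact Order.Ideal.IsPrime.of_mem_or_mem fun hUV => not_and_or.1 hUV

/-- The canonical map from a bitopological space to the spectrum of its lattice `ℒ⁺`, which is the
unit of the duality between spaces and lattices. -/
def toSpec (T : Bitopology A) (a : A) : spec T.posLattice :=
  ⟨T.pointIdeal a, T.pointIdeal a, T.pointIdeal_isPrime a, rfl⟩

theorem isMorphism_toSpec (T : Bitopology A) :
    T.IsMorphism (familyBitopology (spec T.posLattice)) T.toSpec := by
  constructor <;> refine continuous_generateFrom_iff.2 (Set.forall_mem_range.2 fun U => ?_)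
  · have hU : T.toSpec ⁻¹' {q | U ∉ (q : Set T.posLattice)} = U := Set.ext fun _ => not_not
    exact hU ▸ U.2.1
  · exact U.2.2

theorem mem_of_isCompact_of_subset_iUnion_mem {I : Order.Ideal T.posLattice} {V : T.posLattice}
    (hV : @IsCompact A T.pos V) (hVI : (V : Set A) ⊆ ⋃ U : I, (U : T.posLattice)) : V ∈ I := by
  let := T.pos
  have : Nonempty I := I.nonempty.to_subtype
  obtain ⟨U, hVU⟩ := hV.elim_directed_cover _ (fun U : I => U.1.2.1) hVI fun U W =>
    ⟨⟨U ⊔ W, Order.Ideal.sup_mem U.2 W.2⟩, le_sup_left (a := U.1), le_sup_right (b := W.1)⟩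
  exact I.lower hVU U.2

theorem exists_notMem_subset_of_iInter_notMem_subset {I : Order.Ideal T.posLattice}
    (hI : I.IsPrime) {W : Set A} (hW : @IsCompact A T.neg Wᶜ)
    (hIW : ⋂ V : {V // V ∉ I}, ((V : T.posLattice) : Set A) ⊆ W) :
    ∃ V ∉ I, (V : Set A) ⊆ W := by
  let := T.neg
  have : Nonempty {V // V ∉ I} := ⟨⊤, hI.toIsProper.top_notMem⟩
  have hcover : Wᶜ ⊆ ⋃ V : {V // V ∉ I}, ((V : T.posLattice) : Set A)ᶜ := by
    rwa [← Set.compl_iInter, Set.compl_subset_compl]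
  obtain ⟨V, hWV⟩ := hW.elim_directed_cover _ (fun V => V.1.2.2) hcover fun V V' =>
    ⟨⟨V ⊓ V', fun h => (hI.mem_or_mem h).elim V.2 V'.2⟩,
      Set.compl_subset_compl.2 (inf_le_left (a := V.1)),
      Set.compl_subset_compl.2 (inf_le_right (b := V'.1))⟩
  exact ⟨V, V.2, Set.compl_subset_compl.1 hWV⟩

theorem IsAbstractSpectrum.exists_eq_pointIdeal (h : T.IsAbstractSpectrum)
    {I : Order.Ideal T.posLattice} (hI : I.IsPrime) : ∃ a, T.pointIdeal a = I := by
  let := T.pos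
  have hnot : ¬ ⋂ V : {V // V ∉ I}, ((V : T.posLattice) : Set A) ⊆
      ⋃ U : I, (U : T.posLattice) := by
    intro hsub
    have hopen : IsOpen (⋃ U : I, ((U : T.posLattice) : Set A)) := isOpen_iUnion fun U => U.1.2.1
    obtain ⟨V, hVI, hV⟩ := exists_notMem_subset_of_iInter_notMem_subset hI
      (h.compact_neg _ (by rwa [compl_compl])) hsub
    exact hVI (mem_of_isCompact_of_subset_iUnion_mem (h.compact_pos V V.2.2) hV)
  obtain ⟨a, haV, haU⟩ := Set.not_subset.1 hnot
  refine ⟨a, SetLike.ext fun U => ⟨fun hU => ?_, fun hU ha => ?_⟩⟩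
  · by_contra hUI
    exact hU (Set.mem_iInter.1 haV ⟨U, hUI⟩)
  · exact haU (Set.mem_iUnion.2 ⟨⟨U, hU⟩, ha⟩)

theorem IsAbstractSpectrum.toSpec_surjective (h : T.IsAbstractSpectrum) :
    Function.Surjective T.toSpec := by
  rintro ⟨_, I, hI, rfl⟩
  obtain ⟨a, rfl⟩ := h.exists_eq_pointIdeal hI
  exact ⟨a, rfl⟩

end Bitopology

theorem Generates.hom_ext {L : Type*} {L' : Type*} [Lattice L] [BoundedOrder L] [Lattice L']
    [BoundedOrder L'] {G : Set L} (hG : Generates G) {l m : BoundedLatticeHom L L'}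
    (h : Set.EqOn l m G) : l = m := by
  let M : Sublattice L :=
    { carrier := {a | l a = m a}
      supClosed' := fun a (ha : l a = m a) b (hb : l b = m b) =>
        show l (a ⊔ b) = m (a ⊔ b) by rw [map_sup, map_sup, ha, hb]
      infClosed' := fun a (ha : l a = m a) b (hb : l b = m b) =>
        show l (a ⊓ b) = m (a ⊓ b) by rw [map_inf, map_inf, ha, hb] }
  have hM : M = ⊤ := hG M ((map_bot l).trans (map_bot m).symm)
    ((map_top l).trans (map_top m).symm) h
  exact DFunLike.ext l m fun a => (hM ▸ Sublattice.mem_top a : a ∈ M)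

section Family

variable {X : Type u} {S : Set (Set X)}

/-- The subbasic set `{p ∈ S : x ∉ p}` as an element of `ℒ⁺`. For an abstract spectrum `S` this is
the universal map `φ` from `X` to a lattice, and for `S = spec L` it is the Stone representation
of `L`. -/
def avoiding (S : Set (Set X)) (x : X) : (familyBitopology S).posLattice :=
  ⟨{p | x ∉ (p : Set X)}, TopologicalSpace.isOpen_generateFrom_of_mem ⟨x, rfl⟩,
    TopologicalSpace.isOpen_generateFrom_of_mem ⟨x, Set.ext fun _ => not_not.symm⟩⟩

theorem mem_avoiding {x : X} {p : S} : p ∈ (avoiding S x : Set S) ↔ x ∉ (p : Set X) := Iff.rfl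

theorem avoiding_injective_iff : Function.Injective (avoiding S) ↔
    ∀ x y : X, x ≠ y → ∃ p ∈ S, Xor (x ∈ p) (y ∈ p) := by
  refine forall₂_congr fun x y => ?_
  rw [← not_imp_not, ← ne_eq, ← ne_eq]
  refine imp_congr_right fun _ => ?_
  rw [ne_eq, Subtype.ext_iff, Set.ext_iff, not_forall, Subtype.exists]
  simp only [mem_avoiding, not_iff_not, xor_iff_not_iff, exists_prop]

theorem isTopologicalBasis_map_of_range_avoiding_subset
    {M : Sublattice (familyBitopology S).posLattice} (htop : ⊤ ∈ M)
    (hM : Set.range (avoiding S) ⊆ M) :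
    @TopologicalSpace.IsTopologicalBasis S (familyBitopology S).pos
      (M.map (familyBitopology S).posLattice.subtype) := by
  let := (familyBitopology S).pos
  refine TopologicalSpace.isTopologicalBasis_of_subbasis_of_finiteInter (le_antisymm ?_ ?_)
    ⟨⟨⊤, htop, rfl⟩, ?_⟩
  · refine le_generateFrom ?_
    rintro _ ⟨U, -, rfl⟩
    exact U.2.1
  · refine TopologicalSpace.generateFrom_anti ?_
    rintro _ ⟨x, rfl⟩
    exact ⟨avoiding S x, hM ⟨x, rfl⟩, rfl⟩
  · rintro _ ⟨U, hU, rfl⟩ _ ⟨V, hV, rfl⟩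
    exact ⟨U ⊓ V, M.inf_mem hU hV, rfl⟩

theorem generates_range_avoiding (hS : (familyBitopology S).IsAbstractSpectrum) :
    Generates (Set.range (avoiding S)) := by
  let := (familyBitopology S).pos
  intro M hbot htop hM
  have hbasis := isTopologicalBasis_map_of_range_avoiding_subset htop hM
  refine eq_top_iff.2 fun U _ => ?_
  obtain ⟨V, hV, hVU⟩ := mem_of_isCompact_of_isOpen_of_supClosed hbasis ⟨⊥, hbot, rfl⟩
    (Sublattice.supClosed _) (hS.compact_pos U U.2.2) U.2.1
  exact Subtype.ext hVU ▸ hV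

theorem isMorphism_specMap {L : Type v} [Lattice L] (θ : X → L) (h : ∀ q ∈ spec L, θ ⁻¹' q ∈ S) :
    (familyBitopology (spec L)).IsMorphism (familyBitopology S) (specMap θ h) := by
  constructor <;> refine continuous_generateFrom_iff.2 (Set.forall_mem_range.2 fun x => ?_) <;>
    exact TopologicalSpace.isOpen_generateFrom_of_mem ⟨θ x, rfl⟩

theorem preimage_avoiding_toSpec (p : S) : avoiding S ⁻¹' ((familyBitopology S).toSpec p) = p :=
  Set.ext fun _ => not_not

theorem preimage_avoiding_mem (hS : (familyBitopology S).IsAbstractSpectrum)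
    (q : Set (familyBitopology S).posLattice) (hq : q ∈ spec (familyBitopology S).posLattice) :
    avoiding S ⁻¹' q ∈ S := by
  obtain ⟨p, hp⟩ := hS.toSpec_surjective ⟨q, hq⟩
  obtain rfl : ((familyBitopology S).toSpec p : Set _) = q := congrArg Subtype.val hp
  exact preimage_avoiding_toSpec p ▸ p.2

theorem isIsomorphism_specMap_avoiding (hS : (familyBitopology S).IsAbstractSpectrum) :
    (familyBitopology (spec (familyBitopology S).posLattice)).IsIsomorphism (familyBitopology S)
      (specMap (avoiding S) (preimage_avoiding_mem hS)) := by
  have hinv : Function.RightInverse (familyBitopology S).toSpec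
      (specMap (avoiding S) (preimage_avoiding_mem hS)) :=
    fun p => Subtype.ext (preimage_avoiding_toSpec p)
  exact ⟨isMorphism_specMap _ _, _, (familyBitopology S).isMorphism_toSpec,
    hinv.rightInverse_of_surjective hS.toSpec_surjective, hinv⟩

end Family

section Stone

variable {L : Type v} [Lattice L] {a b : L} {q : Set L}

theorem sup_mem_spec_iff (hq : q ∈ spec L) : a ⊔ b ∈ q ↔ a ∈ q ∧ b ∈ q := by
  obtain ⟨I, -, rfl⟩ := hq
  exact Order.Ideal.sup_mem_iff

theorem inf_mem_spec_iff (hq : q ∈ spec L) : a ⊓ b ∈ q ↔ a ∈ q ∨ b ∈ q := by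
  obtain ⟨I, hI, rfl⟩ := hq
  exact ⟨hI.mem_or_mem, fun h => h.elim (I.lower inf_le_left) (I.lower inf_le_right)⟩

theorem avoiding_spec_sup (a b : L) :
    avoiding (spec L) (a ⊔ b) = avoiding (spec L) a ⊔ avoiding (spec L) b :=
  Subtype.ext <| Set.ext fun q => (not_congr (sup_mem_spec_iff q.2)).trans not_and_or

theorem avoiding_spec_inf (a b : L) :
    avoiding (spec L) (a ⊓ b) = avoiding (spec L) a ⊓ avoiding (spec L) b :=
  Subtype.ext <| Set.ext fun q => (not_congr (inf_mem_spec_iff q.2)).trans not_or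

theorem avoiding_spec_mono : Monotone (avoiding (spec L)) := fun a b hab => by
  rw [← sup_eq_right, ← avoiding_spec_sup, sup_eq_right.2 hab]

section Bounded

variable [BoundedOrder L]

theorem bot_mem_spec (hq : q ∈ spec L) : ⊥ ∈ q := by
  obtain ⟨I, -, rfl⟩ := hq
  exact I.bot_mem

theorem top_notMem_spec (hq : q ∈ spec L) : ⊤ ∉ q := by
  obtain ⟨I, hI, rfl⟩ := hq
  exact hI.toIsProper.top_notMem

theorem avoiding_spec_bot : avoiding (spec L) ⊥ = ⊥ :=
  Subtype.ext <| Set.ext fun q => iff_of_false (not_not.2 (bot_mem_spec q.2)) (Set.notMem_empty q)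

theorem avoiding_spec_top : avoiding (spec L) ⊤ = ⊤ :=
  Subtype.ext <| Set.ext fun q => iff_of_true (top_notMem_spec q.2) (Set.mem_univ q)

theorem isTopologicalBasis_notMem_spec :
    @TopologicalSpace.IsTopologicalBasis (spec L) (familyBitopology (spec L)).pos
      (Set.range fun a : L => {q : spec L | a ∉ (q : Set L)}) := by
  let := (familyBitopology (spec L)).pos
  refine TopologicalSpace.isTopologicalBasis_of_subbasis_of_finiteInter rfl
    ⟨⟨⊤, congrArg Subtype.val avoiding_spec_top⟩, ?_⟩
  rintro _ ⟨a, rfl⟩ _ ⟨b, rfl⟩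
  exact ⟨a ⊓ b, congrArg Subtype.val (avoiding_spec_inf a b)⟩

theorem isTopologicalBasis_mem_spec :
    @TopologicalSpace.IsTopologicalBasis (spec L) (familyBitopology (spec L)).neg
      (Set.range fun a : L => {q : spec L | a ∈ (q : Set L)}) := by
  let := (familyBitopology (spec L)).neg
  refine TopologicalSpace.isTopologicalBasis_of_subbasis_of_finiteInter rfl
    ⟨⟨⊥, Set.eq_univ_of_forall fun q => bot_mem_spec q.2⟩, ?_⟩
  rintro _ ⟨a, rfl⟩ _ ⟨b, rfl⟩
  exact ⟨a ⊔ b, Set.ext fun q => sup_mem_spec_iff q.2⟩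

theorem exists_avoiding_spec_le_of_mem {U : (familyBitopology (spec L)).posLattice} {q : spec L}
    (hq : q ∈ (U : Set (spec L))) : ∃ a ∉ (q : Set L), avoiding (spec L) a ≤ U := by
  let := (familyBitopology (spec L)).pos
  obtain ⟨_, ⟨a, rfl⟩, ha, haU⟩ :=
    isTopologicalBasis_notMem_spec.exists_subset_of_mem_open hq U.2.1
  exact ⟨a, ha, haU⟩

theorem exists_le_avoiding_spec_of_notMem {U : (familyBitopology (spec L)).posLattice} {q : spec L}
    (hq : q ∉ (U : Set (spec L))) : ∃ a ∈ (q : Set L), U ≤ avoiding (spec L) a := by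
  let := (familyBitopology (spec L)).neg
  obtain ⟨_, ⟨a, rfl⟩, ha, haU⟩ := isTopologicalBasis_mem_spec.exists_subset_of_mem_open
    (show q ∈ (U : Set (spec L))ᶜ from hq) U.2.2
  exact ⟨a, ha, fun p hpU hap => haU hap hpU⟩

/-- The ideal of the elements of `L` whose Stone representation lies below `U`; it serves with
`filterAbove` to find the element of `L` that represents `U`. -/
def idealBelow (U : (familyBitopology (spec L)).posLattice) : Order.Ideal L where
  carrier := {a | avoiding (spec L) a ≤ U}
  lower' _ _ hba ha := (avoiding_spec_mono hba).trans ha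
  nonempty' := ⟨⊥, avoiding_spec_bot.trans_le bot_le⟩
  directed' a ha b hb :=
    ⟨a ⊔ b, (avoiding_spec_sup a b).trans_le (sup_le ha hb), le_sup_left, le_sup_right⟩

/-- The filter of the elements of `L` whose Stone representation lies above `U`, the counterpart
of `idealBelow`. -/
def filterAbove (U : (familyBitopology (spec L)).posLattice) : Order.PFilter L :=
  Order.IsPFilter.toPFilter (F := {a | U ≤ avoiding (spec L) a}) <| .of_def
    ⟨⊤, le_top.trans_eq avoiding_spec_top.symm⟩
    (fun a ha b hb =>
      ⟨a ⊓ b, (le_inf ha hb).trans_eq (avoiding_spec_inf a b).symm, inf_le_left, inf_le_right⟩)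
    fun hab ha => ha.trans (avoiding_spec_mono hab)

end Bounded

end Stone

section StoneDuality

variable {L : Type v} [DistribLattice L]

theorem avoiding_spec_le_iff {a b : L} :
    avoiding (spec L) a ≤ avoiding (spec L) b ↔ a ≤ b := by
  refine ⟨fun h => ?_, fun h => avoiding_spec_mono h⟩
  by_contra hab
  obtain ⟨J, hJ, hbJ, hdisj⟩ := DistribLattice.prime_ideal_of_disjoint_filter_ideal
    (F := Order.PFilter.principal a) (I := Order.Ideal.principal b)
    (Set.disjoint_left.2 fun c hac hcb => hab (le_trans hac hcb))
  have haJ : a ∉ J := Set.disjoint_left.1 hdisj (le_refl a)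
  exact h (show ⟨J, J, hJ, rfl⟩ ∈ (avoiding (spec L) a : Set (spec L)) from haJ)
    (hbJ Order.Ideal.mem_principal_self)

variable [BoundedOrder L]

theorem avoiding_spec_surjective : Function.Surjective (avoiding (spec L)) := by
  intro U
  suffices h : ¬ Disjoint (filterAbove U : Set L) (idealBelow U) by
    obtain ⟨a, haF, haI⟩ := Set.not_disjoint_iff.1 h
    exact ⟨a, le_antisymm haI haF⟩
  intro hdisj
  obtain ⟨J, hJ, hIJ, hFJ⟩ := DistribLattice.prime_ideal_of_disjoint_filter_ideal hdisj
  by_cases hJU : ⟨J, J, hJ, rfl⟩ ∈ (U : Set (spec L))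
  · obtain ⟨a, haJ, haU⟩ := exists_avoiding_spec_le_of_mem hJU
    exact haJ (hIJ haU)
  · obtain ⟨a, haJ, hUa⟩ := exists_le_avoiding_spec_of_notMem hJU
    exact Set.disjoint_left.1 hFJ hUa haJ

variable (L) in
/-- The Stone representation `L ≅ ℒ⁺(spec L)` of a bounded distributive lattice, sending `a` to the
set of the prime ideals that do not contain `a`. It lets maps into `ℒ⁺(spec L)` be read as maps
into `L`. -/
noncomputable def stoneIso : L ≃o (familyBitopology (spec L)).posLattice :=
  RelIso.ofSurjective
    (OrderEmbedding.ofMapLEIff (avoiding (spec L)) fun _ _ => avoiding_spec_le_iff)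
    avoiding_spec_surjective

variable {X : Type u} {S : Set (Set X)} {θ : X → L} {h : ∀ q ∈ spec L, θ ⁻¹' q ∈ S}

/-- The homomorphism `ℒ⁺(S) → ℒ⁺(spec L) ≅ L` dual to the morphism `spec L → S` given by
`θ : X → L`; it is the extension of `θ` demanded by the universal property. -/
noncomputable def lift
    (hθ : (familyBitopology (spec L)).IsMorphism (familyBitopology S) (specMap θ h)) :
    BoundedLatticeHom (familyBitopology S).posLattice L :=
  ((stoneIso L).symm : BoundedLatticeHom _ _).comp hθ.comap

theorem lift_comp_avoiding
    (hθ : (familyBitopology (spec L)).IsMorphism (familyBitopology S) (specMap θ h)) :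
    lift hθ ∘ avoiding S = θ :=
  funext fun x => (stoneIso L).symm_apply_apply (θ x)

theorem lift_bijective
    (hθ : (familyBitopology (spec L)).IsIsomorphism (familyBitopology S) (specMap θ h)) :
    Function.Bijective (lift hθ.1) :=
  (stoneIso L).symm.bijective.comp hθ.comap_bijective

theorem eq_lift (hS : (familyBitopology S).IsAbstractSpectrum)
    (hθ : (familyBitopology (spec L)).IsMorphism (familyBitopology S) (specMap θ h))
    {l : BoundedLatticeHom (familyBitopology S).posLattice L} (hl : l ∘ avoiding S = θ) :
    l = lift hθ :=
  (generates_range_avoiding hS).hom_ext <| Set.forall_mem_range.2 <|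
    congrFun (hl.trans (lift_comp_avoiding hθ).symm)

end StoneDuality

end Spectra

theorem theorem2p4p1 {X : Type u} (S : Set (Set X))
    (hS : (Spectra.familyBitopology S).IsAbstractSpectrum) :
    ∃ (L : Type u) (_ : DistribLattice L) (_ : BoundedOrder L) (φ : X → L),
      -- the image of `φ` generates `L`
      Spectra.Generates (Set.range φ) ∧
      -- `q ↦ φ⁻¹(q)` is a well defined isomorphism of abstract spectra `spec L → S`
      (Spectra.familyBitopology (Spectra.spec L)).IsAbstractSpectrum ∧
      (∃ h : ∀ q ∈ Spectra.spec L, φ ⁻¹' q ∈ S,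
        (Spectra.familyBitopology (Spectra.spec L)).IsIsomorphism
          (Spectra.familyBitopology S) (Spectra.specMap φ h)) ∧
      -- universal property
      (∀ (L' : Type v) [DistribLattice L'] [BoundedOrder L'] (θ : X → L')
        (h : ∀ q ∈ Spectra.spec L', θ ⁻¹' q ∈ S),
        (Spectra.familyBitopology (Spectra.spec L')).IsMorphism
          (Spectra.familyBitopology S) (Spectra.specMap θ h) →
        ∃! l : BoundedLatticeHom L L', l ∘ φ = θ) ∧
      -- uniqueness up to a unique lattice isomorphism
      (∀ (L₁ : Type v) [DistribLattice L₁] [BoundedOrder L₁] (φ₁ : X → L₁)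
        (h : ∀ q ∈ Spectra.spec L₁, φ₁ ⁻¹' q ∈ S),
        (Spectra.familyBitopology (Spectra.spec L₁)).IsIsomorphism
          (Spectra.familyBitopology S) (Spectra.specMap φ₁ h) →
        ∃! l : BoundedLatticeHom L L₁, Function.Bijective l ∧ l ∘ φ = φ₁) ∧
      -- injectivity
      (Function.Injective φ ↔
        ∀ x y : X, x ≠ y → ∃ p ∈ S, Xor (x ∈ p) (y ∈ p)) := by
  have hiso := Spectra.isIsomorphism_specMap_avoiding hS
  refine ⟨(Spectra.familyBitopology S).posLattice, inferInstance, inferInstance,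
    Spectra.avoiding S, Spectra.generates_range_avoiding hS, hS.of_isIsomorphism hiso,
    ⟨_, hiso⟩, ?_, ?_, Spectra.avoiding_injective_iff⟩
  · intro L' _ _ θ h hθ
    exact ⟨Spectra.lift hθ, Spectra.lift_comp_avoiding hθ, fun _ hl => Spectra.eq_lift hS hθ hl⟩
  · intro L₁ _ _ φ₁ h hφ₁
    exact ⟨Spectra.lift hφ₁.1, ⟨Spectra.lift_bijective hφ₁, Spectra.lift_comp_avoiding hφ₁.1⟩,
      fun _ hl => Spectra.eq_lift hS hφ₁.1 hl.2⟩
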